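/- Full binary trees are finite rooted plane trees in which every node is a leaf or is an internal node with an ordered pair of children (left, right). A *compacted tree* is the plane directed acyclic graph obtained from a full binary tree $T$ by the following compaction. Traverse $T$ in post-order; the first leaf is kept, and every edge leading to a (fringe) subtree that is equal to an already visited one (in particular, every edge to a leaf other than the first) is replaced by a pointer to the root of that earlier copy. The *size* of a compacted tree is its number of internal nodes. Its *spine* is the binary tree obtained by deleting the leaf and all pointers, and its *right height* is the maximal number of right edges on a path from the root to a node in the spine ($0$ if the spine is empty). For $n\ge 0$ let $c_{2,n}$ be the number of compacted trees of size $n$ and right height at most $2$; this number is finite. Then the exponential generating function $C_2(z)=\sum_{n\ge 0} c_{2,n}\frac{z^n}{n!}$, a formal power series, is D-finite (it satisfies a non-trivial homogeneous linear differential equation with polynomial coefficients). More precisely, $$(z^2-3z+1)\,C_2'''(z)-(z^2-6z+6)\,C_2''(z)-(2z-3)\,C_2'(z)=0,\qquad C_2(0)=1,\quad C_2'(0)=1,\quad C_2''(0)=3.$$ -/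

import Mathlib

/-- Plane directed acyclic graphs presented by a spanning structure.
Every vertex is written down exactly once: `leaf` is the sink, `node l r` is an internal vertex
whose left and right outgoing edges are described by `l` and `r`.  An outgoing edge is either an
edge to a vertex written down at that place (`leaf` or `node`), or a pointer `ptr k`, an
edge to the vertex with unique identifier `k`.  The sink has identifier `0`, and the internal
vertices have identifiers `1, 2, 3, …` in post-order.  So the identifiers are only names for the
targets of the pointers and are determined by the unlabelled plane graph. -/
inductive PlaneDag : Type
  | leaf : PlaneDag
  | ptr (k : ℕ) : PlaneDag
  | node (l r : PlaneDag) : PlaneDag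

namespace PlaneDag

/-- The size: the number of internal vertices. -/
def size : PlaneDag → ℕ
  | leaf => 0
  | ptr _ => 0
  | node l r => size l + size r + 1

/-- The spine: delete the leaf and all pointers.  The result is a binary tree in which every node
may or may not have a left child and may or may not have a right child (`nil` = no child). -/
def spine : PlaneDag → BinaryTree Unit
  | leaf => .nil
  | ptr _ => .nil
  | node l r => .node () (spine l) (spine r)

end PlaneDag

/-- The levels of the nodes of a binary tree: the level of a node is the number of right edges on
the path from the root to this node. -/
def nodeLevels : BinaryTree Unit → List ℕ
  | .nil => []
  | .node _ l r => 0 :: (nodeLevels l ++ (nodeLevels r).map (· + 1))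

/-- The right height: the maximal level of a node of the spine (`0` if the spine is empty). -/
def PlaneDag.rightHeight (d : PlaneDag) : ℕ :=
  (nodeLevels d.spine).foldr max 0

/-- The global state of the `UID` procedure. -/
structure UIDState : Type where
  /-- Whether a leaf has already been visited. -/
  leafSeen : Bool
  /-- The table of the pairs `(UID (left T), UID (right T))` inserted so far, in order of insertion.
  The identifier attached to an entry is the value of the counter after its insertion, i.e.
  one plus its position in the table. -/
  table : List (ℕ × ℕ)

/-- The `UID` procedure, traversing a full binary tree in post-order.  Full binary trees are modelled
by `BinaryTree Unit`: `nil` is a leaf, `node () l r` is an internal node with its two children.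
The procedure returns the unique identifier of the tree, the compacted form of the edge leading to the
tree, and the new state.  If the tree has been seen before, that edge is replaced by a pointer to the
vertex with the same identifier. -/
def uid : BinaryTree Unit → UIDState → ℕ × PlaneDag × UIDState
  | .nil, s => (0, if s.leafSeen then .ptr 0 else .leaf, { s with leafSeen := true })
  | .node _ l r, s =>
    match uid l s with
    | (i, dl, s₁) =>
      match uid r s₁ with
      | (j, dr, s₂) =>
        if (i, j) ∈ s₂.table then
          (s₂.table.idxOf (i, j) + 1, .ptr (s₂.table.idxOf (i, j) + 1), s₂)
        else
          (s₂.table.length + 1, .node dl dr, { s₂ with table := s₂.table ++ [(i, j)] })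

/-- The DAG computed by the `UID` procedure, started with an empty table, from a full binary tree. -/
def compaction (t : BinaryTree Unit) : PlaneDag :=
  (uid t { leafSeen := false, table := [] }).2.1

/-- A compacted (binary) tree is a DAG computed by the `UID` procedure from a full binary tree. -/
def IsCompactedTree (d : PlaneDag) : Prop :=
  ∃ t : BinaryTree Unit, compaction t = d

/-- The compacted trees of size `n` and right height at most `k`. -/
def compactedTrees (k n : ℕ) : Set PlaneDag :=
  {d | IsCompactedTree d ∧ d.size = n ∧ d.rightHeight ≤ k}

/-- The exponential generating function `∑ c_{k,n} zⁿ / n!` of the compacted trees of right height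
at most `k`. -/
noncomputable def compactedEGF (k : ℕ) : PowerSeries ℚ :=
  PowerSeries.mk fun n => ((compactedTrees k n).ncard : ℚ) / (n.factorial : ℚ)

/-- A formal power series is D-finite if it satisfies a non-trivial homogeneous linear differential
equation with polynomial coefficients. -/
def IsDFinite {K : Type*} [Field K] (f : PowerSeries K) : Prop :=
  ∃ (r : ℕ) (p : ℕ → Polynomial K), p r ≠ 0 ∧
    ∑ i ∈ Finset.range (r + 1), (p i : PowerSeries K) * (PowerSeries.derivative K)^[i] f = 0

/-! A compacted tree is its spine together with a choice of target for every pointer. Every target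
already in the table is realised by some full binary tree, so the only constraint is that a new
vertex must carry a pair of identifiers not yet in the table. If a child of the vertex is itself a
new vertex, its identifier exceeds all entries of the table and the constraint is automatic. Only a
cherry (two pointers) is constrained: with `m` entries present, it has `(m + 1) ^ 2 - m` choices.
Hence the number of outcomes over a spine depends only on `m` and is multiplicative over the two
subtrees, up to this correction (`card_uidOutcomes`).

Summing over spines gives `totalWeight k m n`, in which the convolution at the root expresses level
`k + 1` through level `k` with start `m + i` and size `n - i`. At level `0` the ratio of consecutive
weights depends only on `m + n`, which the shift preserves, so the recurrence can be applied under
the sum; only boundary terms remain. This yields a recurrence for level `1`, again with coefficients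
in `m + n`, and by the same device one for level `2` at `m = 0`. Read on exponential generating
functions, it is the differential equation. -/

/-- The invariant of the states of the `UID` procedure: the entries of the table are distinct, and
each of them refers to vertices inserted earlier. -/
structure UIDState.Good (s : UIDState) : Prop where
  nodup : s.table.Nodup
  fst_le : ∀ p (h : p < s.table.length), s.table[p].1 ≤ p
  snd_le : ∀ p (h : p < s.table.length), s.table[p].2 ≤ p
  table_eq_nil : s.leafSeen = false → s.table = []

/-- The possible outcomes of the `UID` procedure, described without reference to a tree. -/
inductive UIDOutcome : UIDState → ℕ → PlaneDag → UIDState → Prop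
  | edge (s : UIDState) (i : ℕ) (d : PlaneDag) (s' : UIDState) (hi : i ≤ s.table.length)
      (hd : d = if s.leafSeen then .ptr i else .leaf) (hs : s' = { s with leafSeen := true }) :
      UIDOutcome s i d s'
  | node (s s₁ s₂ : UIDState) (i j : ℕ) (dl dr : PlaneDag) (hl : UIDOutcome s i dl s₁)
      (hr : UIDOutcome s₁ j dr s₂) (hij : (i, j) ∉ s₂.table) :
      UIDOutcome s (s₂.table.length + 1) (.node dl dr)
        { s₂ with table := s₂.table ++ [(i, j)] }

/-! ### Structure of outcomes -/

namespace UIDOutcome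

theorem leafSeen {s s' : UIDState} {i : ℕ} {d : PlaneDag} (h : UIDOutcome s i d s') :
    s'.leafSeen = true := by
  induction h with
  | edge s i d s' hi hd hs => simp [hs]
  | node s s₁ s₂ i j dl dr hl hr hij ihl ihr => exact ihr

theorem length_table {s s' : UIDState} {i : ℕ} {d : PlaneDag} (h : UIDOutcome s i d s') :
    s'.table.length = s.table.length + d.size := by
  induction h with
  | edge s i d s' hi hd hs => subst hs hd; split <;> simp [PlaneDag.size]
  | node s s₁ s₂ i j dl dr hl hr hij ihl ihr => simp [PlaneDag.size, ihl, ihr]; ring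

theorem id_le {s s' : UIDState} {i : ℕ} {d : PlaneDag} (h : UIDOutcome s i d s') :
    i ≤ s'.table.length := by
  cases h with
  | edge _ _ _ _ hi hd hs => simpa [hs] using hi
  | node => simp

theorem good {s s' : UIDState} {i : ℕ} {d : PlaneDag} (h : UIDOutcome s i d s') (hs : s.Good) :
    s'.Good := by
  induction h with
  | edge s i d s' hi hd hs' =>
    subst hs'
    exact ⟨hs.nodup, hs.fst_le, hs.snd_le, by simp⟩
  | node s s₁ s₂ i j dl dr hl hr hij ihl ihr =>
    have h₂ := ihr (ihl hs)
    have hi : i ≤ s₂.table.length := by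
      have := hl.id_le
      have := hr.length_table
      omega
    have hj := hr.id_le
    refine ⟨?_, ?_, ?_, by simp [hr.leafSeen]⟩
    · rw [List.nodup_append]
      refine ⟨h₂.nodup, by simp, ?_⟩
      rintro a ha b hb rfl
      simp only [List.mem_singleton] at hb
      exact hij (hb ▸ ha)
    · intro p hp
      simp only [List.getElem_append]
      split
      · exact h₂.fst_le p _
      · simp at hp ⊢; omega
    · intro p hp
      simp only [List.getElem_append]
      split
      · exact h₂.snd_le p _
      · simp at hp ⊢; omega

/-- The entries of the table are bounded by the number of entries inserted before them. -/
theorem _root_.UIDState.Good.lt_of_mem {s : UIDState} (hs : s.Good) {i j : ℕ}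
    (h : (i, j) ∈ s.table) : i < s.table.length ∧ j < s.table.length := by
  obtain ⟨p, hp, he⟩ := List.getElem_of_mem h
  have h₁ := hs.fst_le p hp
  have h₂ := hs.snd_le p hp
  rw [he] at h₁ h₂
  simp only at h₁ h₂
  omega

/-- An outcome is an edge to an old vertex, or its identifier is the new value of the counter. -/
theorem id_eq {s s' : UIDState} {i : ℕ} {d : PlaneDag} (h : UIDOutcome s i d s')
    (hd : d.spine ≠ .nil) : i = s'.table.length := by
  cases h with
  | edge _ _ _ _ hi hd' hs => subst hd'; split at hd <;> simp [PlaneDag.spine] at hd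
  | node => simp

theorem of_spine_eq_nil {s s' : UIDState} {i : ℕ} {d : PlaneDag} (h : UIDOutcome s i d s')
    (hd : d.spine = .nil) : i ≤ s.table.length ∧ (d = if s.leafSeen then .ptr i else .leaf) ∧
      s' = { s with leafSeen := true } := by
  cases h with
  | edge _ _ _ _ hi hd' hs => exact ⟨hi, hd', hs⟩
  | node => simp [PlaneDag.spine] at hd

/-- A pair that is already in the table can only come from two edges to old vertices. -/
theorem spine_eq_nil_of_mem {s s₁ s₂ : UIDState} {i j : ℕ} {dl dr : PlaneDag}
    (hl : UIDOutcome s i dl s₁) (hr : UIDOutcome s₁ j dr s₂) (hs : s.Good)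
    (hij : (i, j) ∈ s₂.table) : dl.spine = .nil ∧ dr.spine = .nil := by
  have hlt := (hr.good (hl.good hs)).lt_of_mem hij
  have hr' : dr.spine = .nil := by
    by_contra h
    have := hr.id_eq h
    omega
  refine ⟨?_, hr'⟩
  -- The right edge adds no entry, so a new left vertex would still have the table length as
  -- identifier, above every entry.
  by_contra h
  have h₁ := hl.id_eq h
  have h₂ := (hr.of_spine_eq_nil hr').2.2
  subst h₂
  simp only at hlt
  omega

/-- The outcome is determined by the compacted form of the edge. -/
theorem eq_of_dag_eq {s s' s'' : UIDState} {i i' : ℕ} {d : PlaneDag} (hs : s.Good)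
    (h : UIDOutcome s i d s') (h' : UIDOutcome s i' d s'') : i = i' ∧ s' = s'' := by
  induction h generalizing i' s'' with
  | edge s i d s' hi hd hs' =>
    have hd' : d.spine = .nil := by
      subst hd; split <;> rfl
    obtain ⟨h₁, h₂, h₃⟩ := h'.of_spine_eq_nil hd'
    refine ⟨?_, hs'.trans h₃.symm⟩
    -- A pointer shows its target; the first leaf does not, but then the table is empty and `0` is
    -- the only identifier.
    by_cases hl : s.leafSeen
    · simpa [hl, hd] using h₂
    · have := hs.table_eq_nil (by simpa using hl)
      simp only [this, List.length_nil, Nat.le_zero] at hi h₁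
      omega
  | node s s₁ s₂ i j dl dr hl hr hij ihl ihr =>
    cases h' with
    | edge _ _ _ _ _ hd' _ => split at hd' <;> cases hd'
    | node _ s₁' s₂' i' j' _ _ hl' hr' hij' =>
      obtain ⟨rfl, rfl⟩ := ihl hs hl'
      obtain ⟨rfl, rfl⟩ := ihr (hl.good hs) hr'
      exact ⟨rfl, rfl⟩

end UIDOutcome

/-! ### Outcomes versus actual runs of the procedure -/

/-- The `UID` procedure yields an outcome in the sense of `UIDOutcome`. -/
theorem uidOutcome_uid (t : BinaryTree Unit) (s : UIDState) (hs : s.Good) :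
    UIDOutcome s (uid t s).1 (uid t s).2.1 (uid t s).2.2 := by
  induction t generalizing s with
  | nil => exact .edge _ _ _ _ (Nat.zero_le _) rfl rfl
  | node _ l r ihl ihr =>
    have hl := ihl s hs
    have hr := ihr _ (hl.good hs)
    rcases e₁ : uid l s with ⟨i, dl, s₁⟩
    simp only [e₁] at hl hr
    rcases e₂ : uid r s₁ with ⟨j, dr, s₂⟩
    simp only [e₂] at hr
    simp only [uid, e₁, e₂]
    split
    · rename_i hij
      obtain ⟨nl, nr⟩ := hl.spine_eq_nil_of_mem hr hs hij
      obtain ⟨_, _, rfl⟩ := hl.of_spine_eq_nil nl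
      obtain ⟨_, _, rfl⟩ := hr.of_spine_eq_nil nr
      -- A repeated pair needs a nonempty table, so the leaf has been seen and the edge is indeed a
      -- pointer.
      have hls : s.leafSeen := by
        by_contra h
        simp [hs.table_eq_nil (by simpa using h)] at hij
      refine .edge _ _ _ _ ?_ ?_ rfl
      · exact List.idxOf_lt_length_of_mem hij
      · simp [hls]
    · rename_i hij
      exact .node _ _ _ _ _ _ _ hl hr hij

/-- Every identifier in use is the identifier of some tree. -/
theorem exists_uid_eq_ptr (s : UIDState) (hs : s.Good) (hl : s.leafSeen = true) (i : ℕ)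
    (hi : i ≤ s.table.length) : ∃ t, uid t s = (i, .ptr i, s) := by
  induction i using Nat.strong_induction_on with
  | _ i ih =>
    rcases i with _ | p
    · refine ⟨.nil, ?_⟩
      cases s
      simp_all [uid]
    · have hp : p < s.table.length := hi
      have h₁ := hs.fst_le p hp
      have h₂ := hs.snd_le p hp
      obtain ⟨l, el⟩ := ih s.table[p].1 (by omega) (by omega)
      obtain ⟨r, er⟩ := ih s.table[p].2 (by omega) (by omega)
      refine ⟨.node () l r, ?_⟩
      have hm : (s.table[p].1, s.table[p].2) ∈ s.table := List.getElem_mem hp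
      have hx : s.table.idxOf (s.table[p].1, s.table[p].2) = p := hs.nodup.idxOf_getElem p hp
      simp only [uid, el, er, if_pos hm, hx]

theorem UIDOutcome.exists_uid_eq {s s' : UIDState} {i : ℕ} {d : PlaneDag}
    (h : UIDOutcome s i d s') (hs : s.Good) : ∃ t, uid t s = (i, d, s') := by
  induction h with
  | edge s i d s' hi hd hs' =>
    subst hd hs'
    by_cases hl : s.leafSeen
    · obtain ⟨t, ht⟩ := exists_uid_eq_ptr s hs hl i hi
      refine ⟨t, ?_⟩
      rw [ht]
      cases s
      simp_all
    · have := hs.table_eq_nil (by simpa using hl)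
      simp only [this, List.length_nil, Nat.le_zero] at hi
      subst hi
      exact ⟨.nil, by simp [uid, hl]⟩
  | node s s₁ s₂ i j dl dr hl hr hij ihl ihr =>
    obtain ⟨l, el⟩ := ihl hs
    obtain ⟨r, er⟩ := ihr (hl.good hs)
    exact ⟨.node () l r, by simp [uid, el, er, hij]⟩

theorem isCompactedTree_iff (d : PlaneDag) :
    IsCompactedTree d ↔
      ∃ i s, UIDOutcome { leafSeen := false, table := [] } i d s := by
  have hg : UIDState.Good { leafSeen := false, table := [] } :=
    ⟨by simp, by simp, by simp, by simp⟩
  constructor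
  · rintro ⟨t, rfl⟩
    exact ⟨_, _, uidOutcome_uid t _ hg⟩
  · rintro ⟨i, s, h⟩
    obtain ⟨t, ht⟩ := h.exists_uid_eq hg
    exact ⟨t, by simp [compaction, ht]⟩

/-! ### Counting outcomes over a fixed spine -/

open Classical in
/-- The outcomes of the `UID` procedure with a given spine. -/
noncomputable def uidOutcomes : BinaryTree Unit → UIDState → Finset (ℕ × PlaneDag × UIDState)
  | .nil, s => (Finset.range (s.table.length + 1)).image fun i =>
      (i, if s.leafSeen then .ptr i else .leaf, { s with leafSeen := true })
  | .node _ l r, s =>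
      (((uidOutcomes l s).sigma fun x => uidOutcomes r x.2.2).filter
        fun p => (p.1.1, p.2.1) ∉ p.2.2.2.table).image fun p =>
          (p.2.2.2.table.length + 1, .node p.1.2.1 p.2.2.1,
            { p.2.2.2 with table := p.2.2.2.table ++ [(p.1.1, p.2.1)] })

theorem mem_uidOutcomes (t : BinaryTree Unit) (s : UIDState) (x : ℕ × PlaneDag × UIDState) :
    x ∈ uidOutcomes t s ↔ UIDOutcome s x.1 x.2.1 x.2.2 ∧ x.2.1.spine = t := by
  induction t generalizing s x with
  | nil =>
    simp only [uidOutcomes, Finset.mem_image, Finset.mem_range, Nat.lt_succ_iff]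
    constructor
    · rintro ⟨i, hi, rfl⟩
      refine ⟨.edge _ _ _ _ hi rfl rfl, ?_⟩
      dsimp only
      split <;> rfl
    · rintro ⟨h, hn⟩
      obtain ⟨h₁, h₂, h₃⟩ := h.of_spine_eq_nil hn
      exact ⟨x.1, h₁, by rw [← h₂, ← h₃]⟩
  | node a l r ihl ihr =>
    simp only [uidOutcomes, Finset.mem_image, Finset.mem_filter, Finset.mem_sigma, ihl, ihr]
    constructor
    · rintro ⟨p, ⟨⟨⟨hl, el⟩, hr, er⟩, hn⟩, rfl⟩
      exact ⟨.node _ _ _ _ _ _ _ hl hr hn, by simp [PlaneDag.spine, el, er]⟩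
    · rintro ⟨h, hn⟩
      obtain ⟨k, d, s'⟩ := x
      cases h with
      | edge _ _ _ _ hi hd hs => simp only at hd; subst hd; split at hn <;> cases hn
      | node _ s₁ s₂ i j dl dr hl hr hij =>
        simp only [PlaneDag.spine, BinaryTree.node.injEq] at hn
        exact ⟨⟨(i, dl, s₁), (j, dr, s₂)⟩, ⟨⟨⟨hl, hn.2.1⟩, hr, hn.2.2⟩, hij⟩, rfl⟩

theorem PlaneDag.numNodes_spine (d : PlaneDag) : d.spine.numNodes = d.size := by
  induction d with
  | leaf => rfl
  | ptr => rfl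
  | node l r ihl ihr => simp [PlaneDag.spine, BinaryTree.numNodes, PlaneDag.size, ihl, ihr]

/-- The number of outcomes with a given spine, started from a table of length `m`. -/
def spineWeight : BinaryTree Unit → ℕ → ℚ
  | .nil, m => m + 1
  | .node _ l r, m =>
      spineWeight l m * spineWeight r (m + l.numNodes) - if l = .nil ∧ r = .nil then (m : ℚ) else 0

theorem card_uidOutcomes (t : BinaryTree Unit) (s : UIDState) (hs : s.Good) :
    ((uidOutcomes t s).card : ℚ) = spineWeight t s.table.length := by
  classical
  induction t generalizing s with
  | nil =>
    rw [uidOutcomes, Finset.card_image_of_injective]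
    · simp [spineWeight]
    · intro i j h
      simpa using congrArg Prod.fst h
  | node a l r ihl ihr =>
    rw [uidOutcomes, Finset.card_image_of_injOn]
    · have hsig : (((uidOutcomes l s).sigma fun x => uidOutcomes r x.2.2).card : ℚ) =
          spineWeight l s.table.length * spineWeight r (s.table.length + l.numNodes) := by
        rw [Finset.card_sigma, Nat.cast_sum, ← ihl s hs, ← nsmul_eq_mul]
        refine Finset.sum_eq_card_nsmul fun x hx => ?_
        obtain ⟨hout, hsp⟩ := (mem_uidOutcomes _ _ _).1 hx
        rw [ihr _ (hout.good hs), hout.length_table, ← PlaneDag.numNodes_spine, hsp]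
      have hsplit := Finset.card_filter_add_card_filter_not
        (s := (uidOutcomes l s).sigma fun x => uidOutcomes r x.2.2)
        (fun p => (p.1.1, p.2.1) ∈ p.2.2.2.table)
      -- The forbidden choices: for a cherry they biject with the table entries, otherwise there are
      -- none.
      have hin : (((uidOutcomes l s).sigma fun x => uidOutcomes r x.2.2).filter
          fun p => (p.1.1, p.2.1) ∈ p.2.2.2.table).card =
          if l = .nil ∧ r = .nil then s.table.length else 0 := by
        split_ifs with h
        · obtain ⟨rfl, rfl⟩ := h
          rw [← List.toFinset_card_of_nodup hs.nodup]
          refine Finset.card_bij (fun p _ => (p.1.1, p.2.1)) ?_ ?_ ?_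
          · intro p hp
            simp only [Finset.mem_filter, Finset.mem_sigma, mem_uidOutcomes] at hp
            obtain ⟨⟨⟨hl, el⟩, hr, er⟩, hm⟩ := hp
            rw [(hr.of_spine_eq_nil er).2.2, (hl.of_spine_eq_nil el).2.2] at hm
            simpa using hm
          · rintro ⟨⟨i, dl, s₁⟩, j, dr, s₂⟩ hp ⟨⟨i', dl', s₁'⟩, j', dr', s₂'⟩ hp' he
            simp only [Finset.mem_filter, Finset.mem_sigma, mem_uidOutcomes] at hp hp'
            obtain ⟨⟨⟨hl, el⟩, hr, er⟩, hm⟩ := hp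
            obtain ⟨⟨⟨hl', el'⟩, hr', er'⟩, hm'⟩ := hp'
            obtain ⟨-, rfl, rfl⟩ := hl.of_spine_eq_nil el
            obtain ⟨-, rfl, rfl⟩ := hr.of_spine_eq_nil er
            obtain ⟨-, rfl, rfl⟩ := hl'.of_spine_eq_nil el'
            obtain ⟨-, rfl, rfl⟩ := hr'.of_spine_eq_nil er'
            simp only [Prod.mk.injEq] at he
            obtain ⟨rfl, rfl⟩ := he
            rfl
          · rintro ⟨i, j⟩ hm
            rw [List.mem_toFinset] at hm
            have hlt := hs.lt_of_mem hm
            let s₁ : UIDState := { s with leafSeen := true }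
            refine ⟨⟨(i, if s.leafSeen then .ptr i else .leaf, s₁), (j, .ptr j, s₁)⟩, ?_, rfl⟩
            simp only [Finset.mem_filter, Finset.mem_sigma, mem_uidOutcomes]
            refine ⟨⟨⟨.edge _ _ _ _ hlt.1.le rfl rfl, ?_⟩,
              .edge _ _ _ _ hlt.2.le (by simp [s₁]) rfl, rfl⟩, hm⟩
            split <;> rfl
        · rw [Finset.card_eq_zero, Finset.filter_eq_empty_iff]
          intro p hp hm
          simp only [Finset.mem_sigma, mem_uidOutcomes] at hp
          obtain ⟨⟨hl, rfl⟩, hr, rfl⟩ := hp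
          exact h (hl.spine_eq_nil_of_mem hr hs hm)
      rw [hin] at hsplit
      have := congrArg (Nat.cast (R := ℚ)) hsplit
      rw [hsig] at this
      push_cast at this
      rw [spineWeight, ← this]
      ring
    -- The compacted forms of the two edges recover their identifiers and the intermediate states.
    · rintro ⟨⟨i, dl, s₁⟩, j, dr, s₂⟩ hp ⟨⟨i', dl', s₁'⟩, j', dr', s₂'⟩ hp' he
      simp only [Finset.coe_filter, Set.mem_ofPred_eq, Finset.mem_sigma, mem_uidOutcomes] at hp hp'
      simp only [Prod.mk.injEq, PlaneDag.node.injEq] at he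
      obtain ⟨⟨⟨hl, el⟩, hr, er⟩, hm⟩ := hp
      obtain ⟨⟨⟨hl', el'⟩, hr', er'⟩, hm'⟩ := hp'
      obtain ⟨-, ⟨rfl, rfl⟩, -⟩ := he
      obtain ⟨rfl, rfl⟩ := hl.eq_of_dag_eq hs hl'
      obtain ⟨rfl, rfl⟩ := hr.eq_of_dag_eq (hl.good hs) hr'
      rfl

/-! ### Right height and total weights -/

/-- The right height of a binary tree. -/
def treeRightHeight (t : BinaryTree Unit) : ℕ :=
  (nodeLevels t).foldr max 0

theorem treeRightHeight_le_iff (t : BinaryTree Unit) (k : ℕ) :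
    treeRightHeight t ≤ k ↔ ∀ x ∈ nodeLevels t, x ≤ k := by
  unfold treeRightHeight
  induction nodeLevels t with
  | nil => simp
  | cons a l ih => simp [ih]

theorem treeRightHeight_nil_le (k : ℕ) : treeRightHeight .nil ≤ k := by
  simp [treeRightHeight, nodeLevels]

theorem treeRightHeight_node_le_succ (a : Unit) (l r : BinaryTree Unit) (k : ℕ) :
    treeRightHeight (.node a l r) ≤ k + 1 ↔
      treeRightHeight l ≤ k + 1 ∧ treeRightHeight r ≤ k := by
  simp only [treeRightHeight_le_iff, nodeLevels]
  simp [or_imp, forall_and]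

theorem treeRightHeight_node_le_zero (a : Unit) (l r : BinaryTree Unit) :
    treeRightHeight (.node a l r) ≤ 0 ↔ treeRightHeight l ≤ 0 ∧ r = .nil := by
  simp only [treeRightHeight_le_iff, nodeLevels]
  cases r with
  | nil => simp [nodeLevels]
  | node => simpa [nodeLevels] using ⟨1, by simp⟩

/-- The total weight of the spines of size `n` and right height at most `k`, started from a table
of length `m`. -/
def totalWeight (k m n : ℕ) : ℚ :=
  ∑ t ∈ (BinaryTree.treesOfNumNodesEq n).filter (treeRightHeight · ≤ k), spineWeight t m

open Classical in
theorem compactedTrees_eq_image (k n : ℕ) :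
    compactedTrees k n =
      ((((BinaryTree.treesOfNumNodesEq n).filter (treeRightHeight · ≤ k)).sigma
        fun t => uidOutcomes t { leafSeen := false, table := [] }).image
          fun x => x.2.2.1 : Finset PlaneDag) := by
  ext d
  simp only [compactedTrees, Set.mem_ofPred_eq, isCompactedTree_iff, Finset.coe_image, Set.mem_image,
    Finset.mem_coe, Finset.mem_sigma, Finset.mem_filter, BinaryTree.mem_treesOfNumNodesEq,
    mem_uidOutcomes]
  constructor
  · rintro ⟨⟨i, s, h⟩, hn, hk⟩
    exact ⟨⟨d.spine, i, d, s⟩, ⟨⟨d.numNodes_spine.trans hn, hk⟩, h, rfl⟩, rfl⟩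
  · rintro ⟨⟨t, i, d', s⟩, ⟨⟨hn, hk⟩, h, hsp⟩, rfl⟩
    simp only at hn hk h hsp
    subst hsp
    exact ⟨⟨i, s, h⟩, d'.numNodes_spine.symm.trans hn, hk⟩

theorem finite_compactedTrees (k n : ℕ) : (compactedTrees k n).Finite := by
  rw [compactedTrees_eq_image]
  exact Finset.finite_toSet _

theorem ncard_compactedTrees (k n : ℕ) : ((compactedTrees k n).ncard : ℚ) = totalWeight k 0 n := by
  classical
  have hg : UIDState.Good { leafSeen := false, table := [] } :=
    ⟨by simp, by simp, by simp, by simp⟩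
  rw [compactedTrees_eq_image, Set.ncard_coe_finset, Finset.card_image_of_injOn, Finset.card_sigma,
    Nat.cast_sum, totalWeight]
  · exact Finset.sum_congr rfl fun t _ => card_uidOutcomes t _ hg
  · rintro ⟨t, i, d, s⟩ hx ⟨t', i', d', s'⟩ hx' (rfl : d = d')
    simp only [Finset.mem_coe, Finset.mem_sigma, mem_uidOutcomes] at hx hx'
    obtain ⟨-, h, rfl⟩ := hx
    obtain ⟨-, h', rfl⟩ := hx'
    obtain ⟨rfl, rfl⟩ := h.eq_of_dag_eq hg h'
    rfl

/-! ### Recurrences for the total weights -/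

theorem totalWeight_zero (k m : ℕ) : totalWeight k m 0 = m + 1 := by
  simp [totalWeight, treeRightHeight_nil_le, Finset.filter_singleton, spineWeight]

theorem sum_treesOfNumNodesEq_succ (f : BinaryTree Unit → ℚ) (n : ℕ) :
    ∑ t ∈ BinaryTree.treesOfNumNodesEq (n + 1), f t =
      ∑ ij ∈ Finset.HasAntidiagonal.antidiagonal n, ∑ l ∈ BinaryTree.treesOfNumNodesEq ij.1,
        ∑ r ∈ BinaryTree.treesOfNumNodesEq ij.2, f (.node () l r) := by
  rw [BinaryTree.treesOfNumNodesEq_succ, Finset.sum_biUnion]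
  · refine Finset.sum_congr rfl fun ij _ => ?_
    rw [BinaryTree.pairwiseNode, Finset.sum_map, Finset.sum_product]
    rfl
  · rintro ⟨i, j⟩ _ ⟨i', j'⟩ _ hne
    refine Finset.disjoint_left.2 fun t ht ht' => ?_
    obtain ⟨⟨l, r⟩, h, rfl⟩ := Finset.mem_map.1 ht
    obtain ⟨⟨l', r'⟩, h', he⟩ := Finset.mem_map.1 ht'
    obtain ⟨-, rfl, rfl⟩ := BinaryTree.node.inj he
    simp only [Finset.mem_product, BinaryTree.mem_treesOfNumNodesEq] at h h'
    obtain ⟨rfl, rfl⟩ := h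
    obtain ⟨rfl, rfl⟩ := h'
    exact hne rfl

/-- The correction for the cherries occurs for the spine with one node only. -/
theorem sum_antidiagonal_nil (c : ℚ) (n : ℕ) :
    ∑ ij ∈ Finset.HasAntidiagonal.antidiagonal n, ∑ l ∈ BinaryTree.treesOfNumNodesEq ij.1,
        ∑ r ∈ BinaryTree.treesOfNumNodesEq ij.2,
          (if l = .nil ∧ r = .nil then c else 0) = if n = 0 then c else 0 := by
  split_ifs with hn
  · subst hn
    simp
  · refine Finset.sum_eq_zero fun ij hij => Finset.sum_eq_zero fun l hl =>
      Finset.sum_eq_zero fun r hr => if_neg ?_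
    rintro ⟨rfl, rfl⟩
    rw [BinaryTree.mem_treesOfNumNodesEq] at hl hr
    rw [Finset.HasAntidiagonal.mem_antidiagonal] at hij
    simp only [BinaryTree.numNodes] at hl hr
    omega

/-- The total weight of the spines of size `n + 1` in a class of trees that is described by
conditions on the two subtrees of the root. -/
theorem sum_spineWeight_succ (p q : BinaryTree Unit → Prop) [DecidablePred p] [DecidablePred q]
    (hpq : ∀ l r, p (.node () l r) ↔ p l ∧ q r) (hp : p .nil) (hq : q .nil) (m n : ℕ) :
    ∑ t ∈ (BinaryTree.treesOfNumNodesEq (n + 1)).filter p, spineWeight t m =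
      ∑ ij ∈ Finset.HasAntidiagonal.antidiagonal n,
        (∑ l ∈ (BinaryTree.treesOfNumNodesEq ij.1).filter p, spineWeight l m) *
          (∑ r ∈ (BinaryTree.treesOfNumNodesEq ij.2).filter q, spineWeight r (m + ij.1)) -
        if n = 0 then (m : ℚ) else 0 := by
  rw [Finset.sum_filter, sum_treesOfNumNodesEq_succ, ← sum_antidiagonal_nil,
    ← Finset.sum_sub_distrib]
  refine Finset.sum_congr rfl fun ij _ => ?_
  rw [Finset.sum_filter, Finset.sum_filter, Finset.sum_mul_sum, ← Finset.sum_sub_distrib]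
  refine Finset.sum_congr rfl fun l hl => ?_
  rw [← Finset.sum_sub_distrib]
  refine Finset.sum_congr rfl fun r hr => ?_
  rw [BinaryTree.mem_treesOfNumNodesEq] at hl
  by_cases hl' : p l <;> by_cases hr' : q r
  · simp [hpq, hl', hr', spineWeight, hl]
  · have : r ≠ .nil := by rintro rfl; exact hr' hq
    simp [hpq, hr', this]
  · have : l ≠ .nil := by rintro rfl; exact hl' hp
    simp [hpq, hl', this]
  · have : l ≠ .nil := by rintro rfl; exact hl' hp
    simp [hpq, hl', this]

theorem totalWeight_succ (k m n : ℕ) :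
    totalWeight (k + 1) m (n + 1) =
      ∑ i ∈ Finset.range (n + 1), totalWeight (k + 1) m i * totalWeight k (m + i) (n - i) -
        if n = 0 then (m : ℚ) else 0 := by
  rw [totalWeight, sum_spineWeight_succ _ (treeRightHeight · ≤ k)
    (fun l r => treeRightHeight_node_le_succ () l r k) (treeRightHeight_nil_le _)
    (treeRightHeight_nil_le _), Finset.Nat.sum_antidiagonal_eq_sum_range_succ_mk]
  rfl

theorem totalWeight_zero_succ (m n : ℕ) :
    totalWeight 0 m (n + 1) = totalWeight 0 m n * (m + n + 1) - if n = 0 then (m : ℚ) else 0 := by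
  rw [totalWeight, sum_spineWeight_succ _ (· = .nil)
    (fun l r => treeRightHeight_node_le_zero () l r) (treeRightHeight_nil_le _) rfl,
    -- The right subtree is empty, so all `n` remaining nodes lie on the left.
    Finset.sum_eq_single (n, 0)]
  · simp [totalWeight, Finset.filter_singleton, spineWeight]
  · rintro ⟨i, j⟩ hij hne
    refine mul_eq_zero_of_right _ (Finset.sum_eq_zero fun r hr => ?_)
    simp only [Finset.mem_filter, BinaryTree.mem_treesOfNumNodesEq, Finset.HasAntidiagonal.mem_antidiagonal]
      at hr hij
    obtain ⟨hr, rfl⟩ := hr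
    simp only [BinaryTree.numNodes] at hr
    exact absurd (Prod.ext (by simp; omega) hr.symm) hne
  · simp

theorem totalWeight_zero_one (m : ℕ) : totalWeight 0 m 1 = m ^ 2 + m + 1 := by
  rw [totalWeight_zero_succ, totalWeight_zero]
  push_cast
  simp
  ring

theorem totalWeight_zero_add_two (m n : ℕ) :
    totalWeight 0 m (n + 2) = (m + n + 2) * totalWeight 0 m (n + 1) := by
  rw [totalWeight_zero_succ m (n + 1), if_neg (by simp)]
  push_cast
  ring

theorem totalWeight_one_one (m : ℕ) : totalWeight 1 m 1 = m ^ 2 + m + 1 := by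
  rw [totalWeight_succ 0 m 0]
  simp [totalWeight_zero]
  ring

theorem totalWeight_one_two (m : ℕ) :
    totalWeight 1 m 2 = (2 * m + 3) * (m ^ 2 + m + 1) := by
  rw [totalWeight_succ 0 m 1]
  simp [Finset.sum_range_succ, totalWeight_zero, totalWeight_zero_one, totalWeight_one_one]
  ring

/-- Subtracting `m + n + 2` times the previous convolution cancels all but its last terms. General
`m` is needed because level `2` evaluates this at `m = i`. -/
theorem totalWeight_one_add_three (m n : ℕ) :
    totalWeight 1 m (n + 3) =
      (2 * (m + n) + 5) * totalWeight 1 m (n + 2) - (m + n + 1) * totalWeight 1 m (n + 1) := by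
  have h₁ := totalWeight_succ 0 m (n + 1)
  have h₂ := totalWeight_succ 0 m (n + 2)
  rw [if_neg (by simp), sub_zero] at h₁ h₂
  rw [Finset.sum_range_succ] at h₁
  rw [Finset.sum_range_succ, Finset.sum_range_succ] at h₂
  -- The factor is independent of `i`, since `(m + i) + (n - i) = m + n`. The recurrence needs size
  -- at least `1` on the right, whence the split-off terms.
  have h : ∑ i ∈ Finset.range (n + 1), totalWeight 1 m i * totalWeight 0 (m + i) (n + 2 - i) =
      (m + n + 2) *
        ∑ i ∈ Finset.range (n + 1), totalWeight 1 m i * totalWeight 0 (m + i) (n + 1 - i) := by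
    rw [Finset.mul_sum]
    refine Finset.sum_congr rfl fun i hi => ?_
    obtain ⟨j, rfl⟩ := Nat.exists_eq_add_of_le (Finset.mem_range_succ_iff.1 hi)
    rw [show i + j + 2 - i = j + 2 by omega, show i + j + 1 - i = j + 1 by omega,
      totalWeight_zero_add_two]
    push_cast
    ring
  simp only [zero_add] at h₁ h₂
  rw [h] at h₂
  rw [show n + 2 - (n + 1) = 1 by omega, Nat.sub_self, totalWeight_zero, totalWeight_zero_one] at h₂
  rw [Nat.sub_self, totalWeight_zero] at h₁
  push_cast at h₁ h₂
  linear_combination h₂ - (m + n + 2) * h₁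

theorem totalWeight_two_succ (n : ℕ) :
    totalWeight 2 0 (n + 1) =
      ∑ i ∈ Finset.range (n + 1), totalWeight 2 0 i * totalWeight 1 i (n - i) := by
  simpa using totalWeight_succ 1 0 n

theorem totalWeight_two_one : totalWeight 2 0 1 = 1 := by
  simp [totalWeight_two_succ, totalWeight_zero]

theorem totalWeight_two_two : totalWeight 2 0 2 = 3 := by
  simp [totalWeight_two_succ 1, Finset.sum_range_succ, totalWeight_zero, totalWeight_one_one,
    totalWeight_two_one]
  norm_num

theorem totalWeight_two_three : totalWeight 2 0 3 = 15 := by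
  simp [totalWeight_two_succ 2, Finset.sum_range_succ, totalWeight_zero, totalWeight_one_one,
    totalWeight_one_two, totalWeight_two_one, totalWeight_two_two]
  norm_num

/-- The level `1` recurrence has order two, so three consecutive convolutions are combined; their
boundary terms give the quadratic coefficients. -/
theorem totalWeight_two_add_three (n : ℕ) :
    totalWeight 2 0 (n + 3) = (3 * n + 6) * totalWeight 2 0 (n + 2) -
      (n ^ 2 + 5 * n + 3) * totalWeight 2 0 (n + 1) + n * (n + 1) * totalWeight 2 0 n := by
  rcases n with _ | n
  · simp [totalWeight_two_one, totalWeight_two_two, totalWeight_two_three]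
    norm_num
  have h₁ := totalWeight_two_succ (n + 1)
  have h₂ := totalWeight_two_succ (n + 2)
  have h₃ := totalWeight_two_succ (n + 3)
  rw [Finset.sum_range_succ] at h₁
  rw [Finset.sum_range_succ, Finset.sum_range_succ] at h₂
  rw [Finset.sum_range_succ, Finset.sum_range_succ, Finset.sum_range_succ] at h₃
  have h : ∑ i ∈ Finset.range (n + 1), totalWeight 2 0 i * totalWeight 1 i (n + 3 - i) =
      (2 * n + 5) *
        ∑ i ∈ Finset.range (n + 1), totalWeight 2 0 i * totalWeight 1 i (n + 2 - i) -
      (n + 1) * ∑ i ∈ Finset.range (n + 1), totalWeight 2 0 i * totalWeight 1 i (n + 1 - i) := by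
    rw [Finset.mul_sum, Finset.mul_sum, ← Finset.sum_sub_distrib]
    refine Finset.sum_congr rfl fun i hi => ?_
    obtain ⟨j, rfl⟩ := Nat.exists_eq_add_of_le (Finset.mem_range_succ_iff.1 hi)
    rw [show i + j + 3 - i = j + 3 by omega, show i + j + 2 - i = j + 2 by omega,
      show i + j + 1 - i = j + 1 by omega, totalWeight_one_add_three]
    push_cast
    ring
  rw [h] at h₃
  rw [show n + 3 - (n + 1) = 2 by omega, show n + 3 - (n + 2) = 1 by omega, Nat.sub_self,
    totalWeight_zero, totalWeight_one_one, totalWeight_one_two] at h₃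
  rw [show n + 2 - (n + 1) = 1 by omega, Nat.sub_self, totalWeight_zero,
    totalWeight_one_one] at h₂
  rw [Nat.sub_self, totalWeight_zero] at h₁
  rw [show n + 1 + 3 = n + 3 + 1 by ring, show n + 1 + 2 = n + 2 + 1 by ring]
  push_cast at h₁ h₂ h₃ ⊢
  linear_combination h₃ - (2 * n + 5) * h₂ + (n + 1) * h₁

/-! ### The differential equation -/

open PowerSeries in
theorem coeff_iterate_derivative_compactedEGF (k r n : ℕ) :
    coeff n ((derivative ℚ)^[r] (compactedEGF k)) = totalWeight k 0 (n + r) / n.factorial := by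
  induction r generalizing n with
  | zero => simp [compactedEGF, ncard_compactedTrees]
  | succ r ih =>
    rw [Function.iterate_succ_apply', coeff_derivative, ih, Nat.factorial_succ,
      show n + (r + 1) = n + 1 + r by ring]
    push_cast
    have : (n.factorial : ℚ) ≠ 0 := by exact_mod_cast n.factorial_ne_zero
    have : (n : ℚ) + 1 ≠ 0 := by positivity
    field_simp

open PowerSeries in
theorem compactedEGF_two_ode :
    (X ^ 2 - 3 * X + 1) * (derivative ℚ)^[3] (compactedEGF 2)
        - (X ^ 2 - 6 * X + 6) * (derivative ℚ)^[2] (compactedEGF 2)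
        - (2 * X - 3) * derivative ℚ (compactedEGF 2) = 0 := by
  have h₃ := coeff_iterate_derivative_compactedEGF 2 3
  have h₂ := coeff_iterate_derivative_compactedEGF 2 2
  have h₁ := coeff_iterate_derivative_compactedEGF 2 1
  rw [Function.iterate_one] at h₁
  generalize (derivative ℚ)^[3] (compactedEGF 2) = f₃ at *
  generalize (derivative ℚ)^[2] (compactedEGF 2) = f₂ at *
  generalize derivative ℚ (compactedEGF 2) = f₁ at *
  -- Nesting the powers of `X` turns coefficient extraction into index shifts; coefficients `0` and
  -- `1` are then treated apart.
  have hX : (X ^ 2 - 3 * X + 1) * f₃ - (X ^ 2 - 6 * X + 6) * f₂ - (2 * X - 3) * f₁ =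
      X * (X * (f₃ - f₂)) + X * (C (-3) * f₃ + C 6 * f₂ - C 2 * f₁) +
        (f₃ - C 6 * f₂ + C 3 * f₁) := by
    have e₂ : (C 2 : ℚ⟦X⟧) = 2 := map_ofNat _ _
    have e₃ : (C 3 : ℚ⟦X⟧) = 3 := map_ofNat _ _
    have e₆ : (C 6 : ℚ⟦X⟧) = 6 := map_ofNat _ _
    rw [map_neg, e₂, e₃, e₆]
    ring
  rw [hX]
  ext n
  rcases n with _ | _ | n
  · simp only [map_add, map_sub, map_zero, coeff_zero_X_mul, coeff_C_mul, h₁, h₂, h₃]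
    norm_num [totalWeight_two_one, totalWeight_two_two, totalWeight_two_three]
  · have := totalWeight_two_add_three 1
    simp only [map_add, map_sub, map_zero, coeff_succ_X_mul, coeff_zero_X_mul, coeff_C_mul, h₁, h₂,
      h₃]
    norm_num at this ⊢
    linear_combination this
  · have h := totalWeight_two_add_three (n + 2)
    simp only [map_add, map_sub, map_zero, coeff_succ_X_mul, coeff_C_mul, h₁, h₂, h₃,
      Nat.factorial_succ]
    rw [h, show n + 1 + 1 + 1 = n + 3 by ring, show n + 2 + 2 = n + 4 by ring,
      show n + 2 + 1 = n + 3 by ring, show n + 1 + 1 + 2 = n + 4 by ring,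
      show n + 1 + 3 = n + 4 by ring, show n + 1 + 2 = n + 3 by ring,
      show n + 1 + 1 = n + 2 by ring]
    have : (n.factorial : ℚ) ≠ 0 := by exact_mod_cast n.factorial_ne_zero
    have : (n : ℚ) + 1 ≠ 0 := by positivity
    have : (n : ℚ) + 1 + 1 ≠ 0 := by positivity
    push_cast
    field_simp
    ring

open Polynomial in
theorem isDFinite_compactedEGF_two : IsDFinite (compactedEGF 2) := by
  refine ⟨3, fun i => match i with
    | 1 => -(2 * X - 3)
    | 2 => -(X ^ 2 - 6 * X + 6)
    | 3 => X ^ 2 - 3 * X + 1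
    | _ => 0, ?_, ?_⟩
  · intro h
    simpa using congrArg (eval 0) h
  · rw [← compactedEGF_two_ode]
    have e₂ : ((2 : ℚ[X]) : PowerSeries ℚ) = 2 := map_ofNat (coeToPowerSeries.ringHom) 2
    have e₃ : ((3 : ℚ[X]) : PowerSeries ℚ) = 3 := map_ofNat (coeToPowerSeries.ringHom) 3
    have e₆ : ((6 : ℚ[X]) : PowerSeries ℚ) = 6 := map_ofNat (coeToPowerSeries.ringHom) 6
    simp only [Finset.sum_range_succ, Finset.sum_range_zero, coe_add, coe_sub, coe_neg, coe_mul,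
      coe_pow, coe_X, coe_one, coe_zero, e₂, e₃, e₆, Function.iterate_one]
    ring

theorem theorem8p6 :
    -- the counting numbers are well defined: there are finitely many objects of each size
    (∀ n : ℕ, (compactedTrees 2 n).Finite) ∧
    IsDFinite (compactedEGF 2) ∧
    (PowerSeries.X ^ 2 - 3 * PowerSeries.X + 1) *
          (PowerSeries.derivative ℚ)^[3] (compactedEGF 2)
        - (PowerSeries.X ^ 2 - 6 * PowerSeries.X + 6) *
          (PowerSeries.derivative ℚ)^[2] (compactedEGF 2)
        - (2 * PowerSeries.X - 3) * PowerSeries.derivative ℚ (compactedEGF 2) = 0 ∧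
    PowerSeries.constantCoeff (compactedEGF 2) = 1 ∧
    PowerSeries.constantCoeff (PowerSeries.derivative ℚ (compactedEGF 2)) = 1 ∧
    PowerSeries.constantCoeff ((PowerSeries.derivative ℚ)^[2] (compactedEGF 2)) = 3 := by
  have h := fun r => coeff_iterate_derivative_compactedEGF 2 r 0
  simp only [PowerSeries.coeff_zero_eq_constantCoeff_apply] at h
  refine ⟨finite_compactedTrees 2, isDFinite_compactedEGF_two, compactedEGF_two_ode, ?_, ?_, ?_⟩
  · simpa [totalWeight_zero] using h 0
  · simpa [totalWeight_two_one] using h 1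
  · simpa [totalWeight_two_two] using h 2
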